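/- Call a polynomial $p\in\mathbb{C}[x,y]$ primitive if it is nonconstant and cannot be written as $p=f(h)$ with $h\in\mathbb{C}[x,y]$ and $f\in\mathbb{C}[t]$ of degree at least $2$ (equivalently, the general fibers of $p$ are irreducible). For relatively prime natural numbers $k,l$ let $d$ be the weighted degree function with $d(r)=\max\{\,li+kj : a_{ij}\neq 0\,\}$ for a nonzero polynomial $r=\sum a_{ij}x^iy^j\in\mathbb{C}[x,y]$, and let the leading quasi-homogeneous part of $r$ be $\hat r=\sum_{li+kj=d(r)}a_{ij}x^iy^j$. Let $p\in\mathbb{C}[x,y]$ be a primitive polynomial whose zero locus $\{p=0\}\subset\mathbb{C}^2$ is isomorphic to $\mathbb{C}$ as an affine algebraic variety (that is, there are mutually inverse bijections between $\{p=0\}$ and $\mathbb{C}$ given by polynomials). Then there is a polynomial automorphism $\alpha$ of $\mathbb{C}^2$ such that, for $q:=p\circ\alpha$, either $q$ is linear, i.e. a polynomial of degree $1$, or there are relatively prime integers $k,l\ge 2$ and an integer $n\ge 1$ such that the leading quasi-homogeneous part of $q$ with respect to the weighted degree function $d$ of the pair $(k,l)$ is $\hat q(x,y)=(x^k+y^l)^n$.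 -/

import Mathlib

namespace PlaneLine

open MvPolynomial

/-- A polynomial `p` over `ℂ` is primitive when it is nonconstant and not a nontrivial polynomial
in another polynomial: `p = f(h)` with `f` in one variable is possible only for `deg f ≤ 1`
(for two variables this is the same as irreducibility of the general fibres of `p`). -/
def IsPrimitive {σ : Type} (p : MvPolynomial σ ℂ) : Prop :=
  (∀ c : ℂ, p ≠ C c) ∧
    ∀ (f : Polynomial ℂ) (h : MvPolynomial σ ℂ), p = Polynomial.aeval h f → f.natDegree ≤ 1

/-- The set of zeros in affine space of a polynomial. -/
def zeroSet {σ : Type} (p : MvPolynomial σ ℂ) : Set (σ → ℂ) :=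
  {z | eval z p = 0}

/-- The map of affine spaces whose coordinate functions are the polynomials `F i`. -/
noncomputable def polyMap {σ τ : Type} (F : τ → MvPolynomial σ ℂ) : (σ → ℂ) → (τ → ℂ) :=
  fun z i => eval z (F i)

/-- Isomorphism of algebraic subsets of affine spaces: polynomial maps (in both directions)
that restrict to mutually inverse bijections of `Z` and `W`. -/
def AlgIsomorphic {σ τ : Type} (Z : Set (σ → ℂ)) (W : Set (τ → ℂ)) : Prop :=
  ∃ (F : τ → MvPolynomial σ ℂ) (G : σ → MvPolynomial τ ℂ),
    Set.MapsTo (polyMap F) Z W ∧ Set.MapsTo (polyMap G) W Z ∧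
      Set.InvOn (polyMap G) (polyMap F) Z W

/-- The polynomial map with components `α` is an automorphism of affine space: it has a two-sided
inverse that is again a polynomial map. -/
def IsPolyAut {σ : Type} (α : σ → MvPolynomial σ ℂ) : Prop :=
  ∃ β : σ → MvPolynomial σ ℂ,
    Function.LeftInverse (polyMap β) (polyMap α) ∧ Function.RightInverse (polyMap β) (polyMap α)

/-- The polynomial `p ∘ α`, obtained by substituting the components of `α` for the variables. -/
noncomputable def comp {σ τ : Type} (p : MvPolynomial τ ℂ) (α : τ → MvPolynomial σ ℂ) :
    MvPolynomial σ ℂ :=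
  bind₁ α p

theorem eval_comp {σ τ : Type} (p : MvPolynomial τ ℂ) (α : τ → MvPolynomial σ ℂ) (z : σ → ℂ) :
    eval z (comp p α) = eval (polyMap α z) p :=
  eval₂Hom_bind₁ _ _ _ _

/-- The weights of the degree function of the pair `(k, l)`: the first variable `x` has weight `l`
and the second variable `y` has weight `k`, so `d(x^i y^j) = l * i + k * j`. -/
def weight (k l : ℕ) : Fin 2 → ℕ := ![l, k]

/-- The weighted degree `d(r)` of the pair `(k, l)`: the maximum of `l * i + k * j` over the
monomials `x^i y^j` that occur in `r`. -/
noncomputable def wdegree (k l : ℕ) (r : MvPolynomial (Fin 2) ℂ) : ℕ :=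
  weightedTotalDegree (weight k l) r

/-- The leading quasi-homogeneous part of `r` for the pair `(k, l)`: the sum of the terms
`a_ij x^i y^j` of `r` with `l * i + k * j = d(r)`. -/
noncomputable def leadingPart (k l : ℕ) (r : MvPolynomial (Fin 2) ℂ) : MvPolynomial (Fin 2) ℂ :=
  weightedHomogeneousComponent (weight k l) (wdegree k l r) r

end PlaneLine

/-! The isomorphism with the line parametrizes the curve `p = 0` by polynomials `w 0`, `w 1` in one
variable, and the proof is a descent on the sum of their degrees (`IsParametrizedBy.hasNormalForm`).
If one component is constant, the curve lies on a coordinate line and primitivity makes `p` linear.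
If one degree divides the other, a shear cancels a leading term and lowers the sum.

Otherwise the degrees are `g * l` and `g * k` with `k, l ≥ 2` coprime, and the leading part of `p`
can be read off. Let `Q` be the binomial in `x ^ k` and `y ^ l` whose two terms have cancelling
leading terms along `w`. Then `Q(w)` has degree below `g * k * l`, and an integral equation for it
over `ℂ[w 0]` with controlled coefficient degrees gives a polynomial `H` vanishing on the curve with
leading part `Q ^ N` (`exists_annihilator`). By the Nullstellensatz `p` divides a power of `H`.
Leading parts are multiplicative and `Q` is irreducible (`binomial_irreducible`), so the leading
part of `p` is a constant times a power of `Q`; rescaling the coordinates normalizes it. -/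

namespace PlaneLine

open MvPolynomial

/-! ### Weighted degree as degree in an auxiliary variable `z` -/

/-- The substitution `x ↦ x z ^ l`, `y ↦ y z ^ k`, which turns the weighted degree of the pair
`(k, l)` into the degree in `z`. -/
noncomputable def weightHom (k l : ℕ) :
    MvPolynomial (Fin 2) ℂ →ₐ[ℂ] Polynomial (MvPolynomial (Fin 2) ℂ) :=
  aeval fun i => Polynomial.C (X i) * Polynomial.X ^ weight k l i

theorem weightHom_X (k l : ℕ) (i : Fin 2) :
    weightHom k l (X i) = Polynomial.C (X i) * Polynomial.X ^ weight k l i :=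
  aeval_X _ _

theorem weightHom_C (k l : ℕ) (c : ℂ) : weightHom k l (C c) = Polynomial.C (C c) :=
  (weightHom k l).commutes c

theorem weightHom_monomial (k l : ℕ) (d : Fin 2 →₀ ℕ) (c : ℂ) :
    weightHom k l (monomial d c) =
      Polynomial.C (monomial d c) * Polynomial.X ^ Finsupp.weight (weight k l) d := by
  rw [weightHom, aeval_monomial, monomial_eq, Finsupp.weight_apply,
    Finsupp.prod_fintype _ _ fun _ => pow_zero _, Finsupp.prod_fintype _ _ fun _ => pow_zero _,
    Finsupp.sum_fintype d (fun i c => c • weight k l i) (by simp)]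
  simp only [Fin.prod_univ_two, Fin.sum_univ_two, mul_pow, smul_eq_mul, pow_add, ← pow_mul,
    map_mul, map_pow]
  rw [mul_comm (weight k l 0), mul_comm (weight k l 1)]
  change Polynomial.C (C c) * _ = _
  ring

theorem coeff_weightHom (k l n : ℕ) (p : MvPolynomial (Fin 2) ℂ) :
    (weightHom k l p).coeff n = weightedHomogeneousComponent (weight k l) n p := by
  induction p using MvPolynomial.induction_on' with
  | monomial d c =>
    rw [weightHom_monomial, Polynomial.coeff_C_mul_X_pow]
    split_ifs with h
    · exact ((isWeightedHomogeneous_monomial _ _ _ h.symm).weightedHomogeneousComponent_same).symm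
    · exact ((isWeightedHomogeneous_monomial _ _ _ rfl).weightedHomogeneousComponent_ne n h).symm
  | add p q hp hq => rw [map_add, Polynomial.coeff_add, hp, hq, map_add]

theorem weightHom_injective (k l : ℕ) : Function.Injective (weightHom k l) := by
  refine Function.LeftInverse.injective (g := Polynomial.eval 1) fun p => ?_
  induction p using MvPolynomial.induction_on with
  | C a => rw [weightHom_C, Polynomial.eval_C]
  | add p q hp hq => rw [map_add, Polynomial.eval_add, hp, hq]
  | mul_X p i hp => rw [map_mul, Polynomial.eval_mul, hp, weightHom_X]; simp

theorem natDegree_weightHom (k l : ℕ) (p : MvPolynomial (Fin 2) ℂ) :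
    (weightHom k l p).natDegree = wdegree k l p := by
  rcases eq_or_ne p 0 with rfl | hp
  · simp [wdegree, weightedTotalDegree_zero]
  refine le_antisymm ?_ ?_
  · refine Polynomial.natDegree_le_iff_coeff_eq_zero.2 fun n hn => ?_
    rw [coeff_weightHom, weightedHomogeneousComponent_eq_zero _ _ hn]
  · refine Finset.sup_le fun d hd => Polynomial.le_natDegree_of_ne_zero fun h => ?_
    rw [coeff_weightHom] at h
    have := congrArg (coeff d) h
    rw [coeff_weightedHomogeneousComponent, if_pos rfl] at this
    exact mem_support_iff.1 hd this

theorem leadingCoeff_weightHom (k l : ℕ) (p : MvPolynomial (Fin 2) ℂ) :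
    (weightHom k l p).leadingCoeff = leadingPart k l p := by
  rw [Polynomial.leadingCoeff, natDegree_weightHom, coeff_weightHom, leadingPart]

/-- Leading parts are leading coefficients in `z` over a domain, hence multiplicative. -/
theorem leadingPart_mul (k l : ℕ) (p q : MvPolynomial (Fin 2) ℂ) :
    leadingPart k l (p * q) = leadingPart k l p * leadingPart k l q := by
  simp only [← leadingCoeff_weightHom, map_mul, Polynomial.leadingCoeff_mul]

theorem leadingPart_pow (k l n : ℕ) (p : MvPolynomial (Fin 2) ℂ) :
    leadingPart k l (p ^ n) = leadingPart k l p ^ n := by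
  simp only [← leadingCoeff_weightHom, map_pow, Polynomial.leadingCoeff_pow]

theorem wdegree_mul {k l : ℕ} {p q : MvPolynomial (Fin 2) ℂ} (hp : p ≠ 0) (hq : q ≠ 0) :
    wdegree k l (p * q) = wdegree k l p + wdegree k l q := by
  have h := fun {r : MvPolynomial (Fin 2) ℂ} (hr : r ≠ 0) =>
    (map_ne_zero_iff _ (weightHom_injective k l)).2 hr
  rw [← natDegree_weightHom, map_mul, Polynomial.natDegree_mul (h hp) (h hq)]
  simp only [natDegree_weightHom]

theorem leadingPart_isWeightedHomogeneous (k l : ℕ) (p : MvPolynomial (Fin 2) ℂ) :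
    IsWeightedHomogeneous (weight k l) (leadingPart k l p) (wdegree k l p) :=
  weightedHomogeneousComponent_isWeightedHomogeneous _ _

theorem eq_C_of_wdegree_eq_zero {k l : ℕ} (hk : 0 < k) (hl : 0 < l) {p : MvPolynomial (Fin 2) ℂ}
    (h : wdegree k l p = 0) : ∃ c, p = C c := by
  have hw : ∀ i, weight k l i ≠ 0 := by
    intro i
    fin_cases i
    · exact hl.ne'
    · exact hk.ne'
  refine ⟨coeff 0 p, ?_⟩
  have h1 := weightedHomogeneousComponent_zero p hw
  rw [← coeff_weightHom] at h1
  refine weightHom_injective k l ?_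
  rw [weightHom_C, ← h1]
  exact Polynomial.eq_C_of_natDegree_eq_zero ((natDegree_weightHom k l p).trans h)

theorem weightHom_of_isWeightedHomogeneous {k l d : ℕ} {p : MvPolynomial (Fin 2) ℂ}
    (h : IsWeightedHomogeneous (weight k l) p d) :
    weightHom k l p = Polynomial.C p * Polynomial.X ^ d := by
  ext1 n
  rw [coeff_weightHom, Polynomial.coeff_C_mul_X_pow]
  split_ifs with hn
  · rw [hn, h.weightedHomogeneousComponent_same]
  · exact h.weightedHomogeneousComponent_ne n hn

theorem eval_of_isWeightedHomogeneous {k l d : ℕ} {p : MvPolynomial (Fin 2) ℂ}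
    (h : IsWeightedHomogeneous (weight k l) p d) (z : ℂ) (v : Fin 2 → ℂ) :
    eval (fun i => v i * z ^ weight k l i) p = z ^ d * eval v p := by
  have h1 : ∀ q : MvPolynomial (Fin 2) ℂ, eval (fun i => v i * z ^ weight k l i) q =
      Polynomial.eval₂ (eval v) z (weightHom k l q) := by
    intro q
    induction q using MvPolynomial.induction_on with
    | C a => rw [weightHom_C, Polynomial.eval₂_C, eval_C, eval_C]
    | add p q hp hq => rw [map_add, map_add, Polynomial.eval₂_add, hp, hq]
    | mul_X p i hp =>
      rw [map_mul, map_mul, Polynomial.eval₂_mul, hp, weightHom_X]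
      simp [Polynomial.eval₂_mul, Polynomial.eval₂_pow]
  rw [h1, weightHom_of_isWeightedHomogeneous h, Polynomial.eval₂_mul, Polynomial.eval₂_C,
    Polynomial.eval₂_pow, Polynomial.eval₂_X, mul_comm]

/-! ### Irreducibility of weighted homogeneous binomials -/

theorem binomial_isWeightedHomogeneous (k l : ℕ) (a b : ℂ) :
    IsWeightedHomogeneous (weight k l) (C b * X 0 ^ k - C a * X 1 ^ l : MvPolynomial (Fin 2) ℂ)
      (k * l) := by
  refine IsWeightedHomogeneous.sub (IsWeightedHomogeneous.C_mul ?_ _)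
    (IsWeightedHomogeneous.C_mul ?_ _)
  · exact (isWeightedHomogeneous_X ℂ (weight k l) 0).pow k
  · have := (isWeightedHomogeneous_X ℂ (weight k l) 1).pow l
    rwa [smul_eq_mul, mul_comm] at this

/-- A divisor of a weighted homogeneous polynomial that restricts to a multiple of `x ^ n` on a
coordinate axis restricts to a monomial there. -/
theorem weight_of_dvd_axis {k l d n : ℕ} {F G : MvPolynomial (Fin 2) ℂ} {c : ℂ} (hc : c ≠ 0)
    (hF : IsWeightedHomogeneous (weight k l) F d) (i : Fin 2)
    (h : aeval (Pi.single i (Polynomial.X : Polynomial ℂ)) (F * G) =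
      Polynomial.C c * Polynomial.X ^ n) :
    ∃ m ≤ n, weight k l i * m = d := by
  set fx := aeval (Pi.single i (Polynomial.X : Polynomial ℂ)) F with hfx
  have hdvd : fx ∣ Polynomial.X ^ n := by
    have h1 : fx ∣ Polynomial.C c * Polynomial.X ^ n := by
      rw [← h, map_mul]; exact dvd_mul_right _ _
    exact (Polynomial.isUnit_C.2 hc.isUnit).dvd_mul_left.1 h1
  obtain ⟨m, hm, u, hu⟩ := (dvd_prime_pow Polynomial.prime_X n).1 hdvd
  refine ⟨m, hm, ?_⟩
  have heval : ∀ s : ℂ, eval (Pi.single i s) F = fx.eval s := by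
    intro s
    have h2 : (Polynomial.aeval s).comp (aeval (Pi.single i (Polynomial.X : Polynomial ℂ))) =
        aeval (R := ℂ) (Pi.single i s) := by
      ext j
      rcases eq_or_ne j i with rfl | hj
      · simp
      · simp [hj]
    rw [hfx, ← Polynomial.coe_aeval_eq_eval]
    exact (DFunLike.congr_fun h2 F).symm
  obtain ⟨e, he, hue⟩ := Polynomial.isUnit_iff.1 u.isUnit
  have hx : ∀ s : ℂ, fx.eval s * e = s ^ m := by
    intro s
    have := congrArg (Polynomial.eval s) hu
    rwa [← hue, Polynomial.eval_mul, Polynomial.eval_C, Polynomial.eval_pow,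
      Polynomial.eval_X] at this
  -- On the axis `F` is `s ^ m / e`. Comparing its values at `s = 1` and `s = 2 ^ weight k l i` with
  -- homogeneity identifies two powers of 2, hence their exponents.
  have key := eval_of_isWeightedHomogeneous hF 2 (Pi.single i 1)
  have hpt : (fun j => (Pi.single i (1 : ℂ) : Fin 2 → ℂ) j * 2 ^ weight k l j) =
      Pi.single i (2 ^ weight k l i) := by
    ext j
    rcases eq_or_ne j i with rfl | hj
    · simp
    · simp [hj]
  rw [hpt, heval, heval] at key
  have h3 := congrArg (· * e) key
  simp only [mul_assoc, hx, one_pow, mul_one, ← pow_mul] at h3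
  exact Nat.pow_right_injective le_rfl (by exact_mod_cast h3)

theorem binomial_ne_zero {k l : ℕ} (hl : 0 < l) {a b : ℂ} (hb : b ≠ 0) :
    (C b * X 0 ^ k - C a * X 1 ^ l : MvPolynomial (Fin 2) ℂ) ≠ 0 := by
  intro h
  have := congrArg (eval ![1, 0]) h
  simp [hl.ne', hb] at this

theorem leadingPart_eq_self {k l d : ℕ} {p : MvPolynomial (Fin 2) ℂ} (hp : p ≠ 0)
    (h : IsWeightedHomogeneous (weight k l) p d) : leadingPart k l p = p ∧ wdegree k l p = d := by
  constructor
  · rw [← leadingCoeff_weightHom, weightHom_of_isWeightedHomogeneous h,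
      Polynomial.leadingCoeff_C_mul_X_pow]
  · rw [← natDegree_weightHom, weightHom_of_isWeightedHomogeneous h,
      Polynomial.natDegree_C_mul_X_pow _ _ hp]

/-- The leading part of a factor divides the binomial, so it restricts to monomials of exponents `i
≤ k` and `j ≤ l` on the two axes, with `l * i = k * j` its weighted degree. Coprimality forces `i =
0` or `i = k`, so one of the two factors has weighted degree zero and is constant. -/
theorem binomial_irreducible {k l : ℕ} (hk : 0 < k) (hl : 0 < l) (hkl : k.Coprime l) {a b : ℂ}
    (ha : a ≠ 0) (hb : b ≠ 0) :
    Irreducible (C b * X 0 ^ k - C a * X 1 ^ l : MvPolynomial (Fin 2) ℂ) := by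
  set Q : MvPolynomial (Fin 2) ℂ := C b * X 0 ^ k - C a * X 1 ^ l with hQ
  have hQ0 : Q ≠ 0 := binomial_ne_zero hl hb
  obtain ⟨hQl, hQd⟩ := leadingPart_eq_self hQ0 (binomial_isWeightedHomogeneous k l a b)
  refine ⟨fun h => ?_, fun f g hfg => ?_⟩
  · obtain ⟨r, -, hr⟩ := isUnit_iff_eq_C_of_isReduced.1 h
    have h1 := isWeightedHomogeneous_C (weight k l) r
    rw [← hr] at h1
    have := (binomial_isWeightedHomogeneous k l a b).inj_right hQ0 h1
    exact (Nat.mul_pos hk hl).ne' this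
  have hf0 : f ≠ 0 := by rintro rfl; exact hQ0 (by rw [hfg, zero_mul])
  have hg0 : g ≠ 0 := by rintro rfl; exact hQ0 (by rw [hfg, mul_zero])
  have hprod : leadingPart k l f * leadingPart k l g = Q := by
    rw [← leadingPart_mul, ← hfg, hQl]
  have hdeg : wdegree k l f + wdegree k l g = k * l := by
    rw [← wdegree_mul hf0 hg0, ← hfg, hQd]
  have hunit : ∀ q : MvPolynomial (Fin 2) ℂ, q ≠ 0 → wdegree k l q = 0 → IsUnit q := by
    intro q hq h
    obtain ⟨c, rfl⟩ := eq_C_of_wdegree_eq_zero hk hl h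
    refine (IsUnit.mk0 c ?_).map C
    rintro rfl
    exact hq (map_zero _)
  obtain ⟨i, hik, hi⟩ := weight_of_dvd_axis (G := leadingPart k l g) (n := k) hb
    (leadingPart_isWeightedHomogeneous k l f) 0 (by
      rw [hprod]; simp [hQ, hl.ne', Polynomial.C_eq_algebraMap])
  obtain ⟨j, hjl, hj⟩ := weight_of_dvd_axis (G := leadingPart k l g) (n := l) (neg_ne_zero.2 ha)
    (leadingPart_isWeightedHomogeneous k l f) 1 (by
      rw [hprod]; simp [hQ, hk.ne', Polynomial.C_eq_algebraMap, map_neg])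
  change l * i = _ at hi
  change k * j = _ at hj
  have hki : k ∣ i := hkl.dvd_of_dvd_mul_left (hi.trans hj.symm ▸ dvd_mul_right k j)
  rcases Nat.eq_zero_or_pos i with rfl | hpos
  · exact Or.inl (hunit f hf0 (by rw [← hi, mul_zero]))
  · have : i = k := le_antisymm hik (Nat.le_of_dvd hpos hki)
    subst this
    refine Or.inr (hunit g hg0 ?_)
    rw [← hi, mul_comm l] at hdeg
    omega

/-! ### Integral equations over `ℂ[u]` with degree bounds -/

/-- The polynomials in `z` over `ℂ[t]` whose `j`-th coefficient is `w(u)` for some `w` with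
`A * deg w ≤ j`. -/
noncomputable def reesSubalgebra (A : ℕ) (u : Polynomial ℂ) :
    Subalgebra ℂ (Polynomial (Polynomial ℂ)) where
  carrier := {s | ∀ j, ∃ w : Polynomial ℂ, A * w.natDegree ≤ j ∧ s.coeff j = w.comp u}
  mul_mem' := by
    intro s t hs ht j
    choose f hf hfs using hs
    choose g hg hgt using ht
    refine ⟨∑ x ∈ Finset.HasAntidiagonal.antidiagonal j, f x.1 * g x.2, ?_, ?_⟩
    · rcases Nat.eq_zero_or_pos A with rfl | hA
      · simp
      rw [mul_comm, ← Nat.le_div_iff_mul_le hA]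
      refine Polynomial.natDegree_sum_le_of_forall_le _ _ fun x hx => ?_
      rw [Nat.le_div_iff_mul_le hA, mul_comm, ← Finset.HasAntidiagonal.mem_antidiagonal.1 hx]
      calc A * (f x.1 * g x.2).natDegree ≤ A * ((f x.1).natDegree + (g x.2).natDegree) :=
            Nat.mul_le_mul_left _ Polynomial.natDegree_mul_le
        _ ≤ x.1 + x.2 := by rw [mul_add]; exact add_le_add (hf _) (hg _)
    · rw [Polynomial.coeff_mul, Polynomial.sum_comp]
      exact Finset.sum_congr rfl fun x _ => by rw [Polynomial.mul_comp, hfs, hgt]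
  add_mem' := by
    intro s t hs ht j
    obtain ⟨f, hf, hfs⟩ := hs j
    obtain ⟨g, hg, hgt⟩ := ht j
    refine ⟨f + g, ?_, by rw [Polynomial.coeff_add, Polynomial.add_comp, hfs, hgt]⟩
    have := Polynomial.natDegree_add_le f g
    rcases le_max_iff.1 this with h | h
    · exact (Nat.mul_le_mul_left A h).trans hf
    · exact (Nat.mul_le_mul_left A h).trans hg
  algebraMap_mem' := by
    intro c j
    rcases Nat.eq_zero_or_pos j with rfl | hj
    · refine ⟨Polynomial.C c, by simp, ?_⟩
      rw [Polynomial.C_comp, Polynomial.algebraMap_apply, Polynomial.coeff_C_zero]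
      rfl
    · refine ⟨0, by simp, ?_⟩
      rw [Polynomial.zero_comp, Polynomial.algebraMap_apply, Polynomial.coeff_C_of_ne_zero hj.ne']

theorem X_mem_reesSubalgebra (A : ℕ) (u : Polynomial ℂ) : Polynomial.X ∈ reesSubalgebra A u := by
  intro j
  rw [Polynomial.coeff_X]
  split_ifs
  · exact ⟨1, by simp, by simp⟩
  · exact ⟨0, by simp, by simp⟩

theorem C_mul_X_pow_mem_reesSubalgebra (A : ℕ) (u : Polynomial ℂ) :
    Polynomial.C u * Polynomial.X ^ A ∈ reesSubalgebra A u := by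
  intro j
  rw [Polynomial.coeff_C_mul_X_pow]
  split_ifs with h
  · exact ⟨Polynomial.X, by simp [h], by simp⟩
  · exact ⟨0, by simp, by simp⟩

/-- Homogenization: `e(t) z ^ δ` is a form of degree `δ` in `z` and `t z`. -/
theorem C_mul_X_pow_eq_sum {δ : ℕ} {e : Polynomial ℂ} (he : e.natDegree ≤ δ) :
    (Polynomial.C e * Polynomial.X ^ δ : Polynomial (Polynomial ℂ)) =
      ∑ i ∈ Finset.range (δ + 1), algebraMap ℂ _ (e.coeff i) *
        (Polynomial.X ^ (δ - i) * (Polynomial.C Polynomial.X * Polynomial.X) ^ i) := by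
  conv_lhs => rw [e.as_sum_range' (δ + 1) (Nat.lt_succ_of_le he)]
  rw [map_sum, Finset.sum_mul]
  refine Finset.sum_congr rfl fun i hi => ?_
  have hi' : δ - i + i = δ := Nat.sub_add_cancel (Nat.lt_succ_iff.1 (Finset.mem_range.1 hi))
  rw [← Polynomial.C_mul_X_pow_eq_monomial, Polynomial.algebraMap_apply, map_mul, map_pow, mul_pow]
  conv_lhs => rw [← hi', pow_add]
  change Polynomial.C (Polynomial.C (e.coeff i)) * _ * _ =
    Polynomial.C (Polynomial.C (e.coeff i)) * _
  ring

/-- Homogenizing `u` in `z` and `t z`, and dividing by its leading coefficient, gives a monic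
equation for `t z` whose constant term involves `u z ^ A`, an element of the subalgebra. -/
theorem isIntegral_reesSubalgebra {u : Polynomial ℂ} (hu : 0 < u.natDegree) :
    IsIntegral (reesSubalgebra u.natDegree u)
      (Polynomial.C Polynomial.X * Polynomial.X : Polynomial (Polynomial ℂ)) := by
  set A := u.natDegree with hA
  set S := reesSubalgebra A u
  have hu0 : u.leadingCoeff ≠ 0 :=
    Polynomial.leadingCoeff_ne_zero.2 (Polynomial.ne_zero_of_natDegree_gt hu)
  let z : S := ⟨Polynomial.X, X_mem_reesSubalgebra A u⟩
  let U : S := ⟨_, C_mul_X_pow_mem_reesSubalgebra A u⟩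
  let low : Polynomial S := ∑ i ∈ Finset.range A,
    Polynomial.C (algebraMap ℂ S (u.leadingCoeff⁻¹ * u.coeff i) * z ^ (A - i)) * Polynomial.X ^ i
  refine ⟨Polynomial.X ^ A +
    (low + Polynomial.C (algebraMap ℂ S (-u.leadingCoeff⁻¹) * U)), ?_, ?_⟩
  · refine Polynomial.monic_X_pow_add ?_
    refine (Polynomial.degree_add_le _ _).trans_lt (max_lt ?_ ?_)
    · refine (Polynomial.degree_sum_le _ _).trans_lt ?_
      refine (Finset.sup_lt_iff (WithBot.bot_lt_coe A)).2 ?_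
      exact fun i hi => (Polynomial.degree_C_mul_X_pow_le _ _).trans_lt
        (WithBot.coe_lt_coe.2 (Finset.mem_range.1 hi))
    · exact Polynomial.degree_C_le.trans_lt (WithBot.coe_lt_coe.2 hu)
  · have h := C_mul_X_pow_eq_sum (e := u) (δ := A) le_rfl
    rw [Finset.sum_range_succ, Nat.sub_self, pow_zero, one_mul] at h
    rw [Polynomial.eval₂_add, Polynomial.eval₂_add, Polynomial.eval₂_finsetSum,
      Polynomial.eval₂_pow, Polynomial.eval₂_X, Polynomial.eval₂_C]
    have hU : algebraMap S (Polynomial (Polynomial ℂ)) (algebraMap ℂ S (-u.leadingCoeff⁻¹) * U) =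
        algebraMap ℂ _ (-u.leadingCoeff⁻¹) * (Polynomial.C u * Polynomial.X ^ A) := rfl
    have hlead : algebraMap ℂ (Polynomial (Polynomial ℂ)) (-u.leadingCoeff⁻¹) *
        (algebraMap ℂ _ (u.coeff A) * (Polynomial.C Polynomial.X * Polynomial.X) ^ A) +
        (Polynomial.C Polynomial.X * Polynomial.X) ^ A = 0 := by
      rw [← mul_assoc, ← map_mul]
      change algebraMap ℂ _ (-u.leadingCoeff⁻¹ * u.leadingCoeff) * _ + _ = _
      rw [neg_mul, inv_mul_cancel₀ hu0]
      nth_rw 2 [← one_mul ((Polynomial.C Polynomial.X * Polynomial.X) ^ A)]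
      rw [← map_one (algebraMap ℂ (Polynomial (Polynomial ℂ))), ← add_mul, ← map_add,
        neg_add_cancel, map_zero, zero_mul]
    have hadd : ∀ a b c d : Polynomial (Polynomial ℂ), a + b = 0 → c + d = 0 →
        b + (c + (d + a)) = 0 := fun a b c d h₁ h₂ => by linear_combination h₁ + h₂
    rw [hU, h, mul_add]
    refine hadd _ _ _ _ hlead ?_
    rw [Finset.mul_sum, ← Finset.sum_add_distrib]
    refine Finset.sum_eq_zero fun i _ => ?_
    rw [Polynomial.eval₂_mul, Polynomial.eval₂_C, Polynomial.eval₂_pow, Polynomial.eval₂_X]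
    change (algebraMap ℂ _ (u.leadingCoeff⁻¹ * u.coeff i) * Polynomial.X ^ (A - i)) * _ + _ = _
    rw [← mul_assoc (algebraMap _ _ _), ← map_mul, mul_assoc, ← add_mul, ← map_add, neg_mul,
      add_neg_cancel, map_zero, zero_mul]

/-- A polynomial of degree at most `δ` is integral over `ℂ[u]`, with the degrees of the
coefficients bounded by the expected multiples of `δ`. -/
theorem exists_weighted_integral_equation {u e : Polynomial ℂ} (hu : 0 < u.natDegree) {δ : ℕ}
    (he : e.natDegree ≤ δ) :
    ∃ (N : ℕ) (c : ℕ → Polynomial ℂ), (∀ i < N, u.natDegree * (c i).natDegree ≤ (N - i) * δ) ∧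
      e ^ N + ∑ i ∈ Finset.range N, (c i).comp u * e ^ i = 0 := by
  set S := reesSubalgebra u.natDegree u
  have hE : IsIntegral S (Polynomial.C e * Polynomial.X ^ δ : Polynomial (Polynomial ℂ)) := by
    rw [C_mul_X_pow_eq_sum he]
    have hz : IsIntegral S (Polynomial.X : Polynomial (Polynomial ℂ)) :=
      isIntegral_algebraMap (R := S) (x := ⟨Polynomial.X, X_mem_reesSubalgebra _ u⟩)
    refine IsIntegral.sum _ fun i _ => IsIntegral.mul ?_
      ((hz.pow _).mul ((isIntegral_reesSubalgebra hu).pow _))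
    exact isIntegral_algebraMap (R := S) (x := algebraMap ℂ S (e.coeff i))
  obtain ⟨P, hP, hroot⟩ := hE
  set N := P.natDegree
  choose w hw hwc using fun i => (P.coeff i).2 ((N - i) * δ)
  refine ⟨N, w, fun i _ => hw i, ?_⟩
  rw [Polynomial.eval₂_eq_sum_range, Finset.sum_range_succ, hP.coeff_natDegree, map_one,
    one_mul] at hroot
  -- Extracting the coefficient of `z ^ (N * δ)` picks the part of the `i`-th coefficient in degree
  -- `(N - i) * δ`, where membership in the subalgebra bounds the degree of `w i`.
  have h := congrArg (fun q => Polynomial.coeff q (N * δ)) hroot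
  simp only [Polynomial.coeff_add, Polynomial.finsetSum_coeff, mul_pow, ← map_pow, ← pow_mul] at h
  rw [mul_comm δ N, Polynomial.coeff_C_mul_X_pow, if_pos rfl, Polynomial.coeff_zero] at h
  rw [add_comm, ← h]
  congr 1
  refine Finset.sum_congr rfl fun i hi => ?_
  have hi' : N * δ = (N - i) * δ + δ * i := by
    rw [mul_comm δ i, ← add_mul, Nat.sub_add_cancel (Finset.mem_range.1 hi).le]
  rw [← mul_assoc, hi', Polynomial.coeff_mul_X_pow, Polynomial.coeff_mul_C, ← hwc]
  rfl

/-! ### An equation of the curve whose leading part is a binomial power -/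

theorem natDegree_sub_lt_of_leadingCoeff_eq {f h : Polynomial ℂ} {M : ℕ} (hM : 0 < M)
    (hf : f.natDegree = M) (hh : h.natDegree = M) (hlead : f.leadingCoeff = h.leadingCoeff) :
    (f - h).natDegree < M := by
  refine lt_of_le_of_ne ?_ fun heq => ?_
  · exact (Polynomial.natDegree_sub_le f h).trans (by simp [hf, hh])
  · have h0 : (f - h).leadingCoeff = 0 := by
      rw [Polynomial.leadingCoeff, heq, Polynomial.coeff_sub, sub_eq_zero]
      rwa [Polynomial.leadingCoeff, Polynomial.leadingCoeff, hf, hh] at hlead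
    rw [Polynomial.leadingCoeff_eq_zero.1 h0, Polynomial.natDegree_zero] at heq
    omega

theorem natDegree_weightHom_aeval_X_le (k l : ℕ) (c : Polynomial ℂ) :
    (weightHom k l (Polynomial.aeval (X 0) c)).natDegree ≤ l * c.natDegree := by
  rw [Polynomial.aeval_eq_sum_range, map_sum]
  refine Polynomial.natDegree_sum_le_of_forall_le _ _ fun i hi => ?_
  rw [map_smul, map_pow, weightHom_X, mul_pow, ← map_pow, ← pow_mul]
  refine (Polynomial.natDegree_smul_le _ _).trans
    ((Polynomial.natDegree_C_mul_X_pow_le _ _).trans ?_)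
  exact Nat.mul_le_mul_left l (Nat.lt_succ_iff.1 (Finset.mem_range.1 hi))

/-- A polynomial curve `t ↦ w(t)` whose components have degrees in the ratio `l : k` satisfies an
equation whose leading part for the pair `(k, l)` is a power of a binomial. -/
theorem exists_annihilator {w : Fin 2 → Polynomial ℂ} {g k l : ℕ} (hg : 0 < g) (hk : 0 < k)
    (hl : 0 < l) (h0 : (w 0).natDegree = g * l) (h1 : (w 1).natDegree = g * k) :
    ∃ (N : ℕ) (H : MvPolynomial (Fin 2) ℂ), aeval w H = 0 ∧ leadingPart k l H =
      (C ((w 1).leadingCoeff ^ l) * X 0 ^ k - C ((w 0).leadingCoeff ^ k) * X 1 ^ l) ^ N := by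
  set a := (w 0).leadingCoeff
  set b := (w 1).leadingCoeff
  have hw0 : w 0 ≠ 0 := Polynomial.ne_zero_of_natDegree_gt (n := 0) (h0 ▸ Nat.mul_pos hg hl)
  have hw1 : w 1 ≠ 0 := Polynomial.ne_zero_of_natDegree_gt (n := 0) (h1 ▸ Nat.mul_pos hg hk)
  have ha : a ≠ 0 := Polynomial.leadingCoeff_ne_zero.2 hw0
  have hb : b ≠ 0 := Polynomial.leadingCoeff_ne_zero.2 hw1
  set Q : MvPolynomial (Fin 2) ℂ := C (b ^ l) * X 0 ^ k - C (a ^ k) * X 1 ^ l with hQ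
  have hQ0 : Q ≠ 0 := binomial_ne_zero hl (pow_ne_zero _ hb)
  have hQhom : weightHom k l Q = Polynomial.C Q * Polynomial.X ^ (k * l) :=
    weightHom_of_isWeightedHomogeneous (binomial_isWeightedHomogeneous k l _ _)
  set e := aeval w Q with he
  -- Both terms of `Q(w)` have degree `g * k * l` and leading coefficient `a ^ k * b ^ l`, so they
  -- cancel at the top.
  have hedeg : e.natDegree < g * (k * l) := by
    have heq : e = Polynomial.C (b ^ l) * w 0 ^ k - Polynomial.C (a ^ k) * w 1 ^ l := by
      simp [he, hQ, Polynomial.C_eq_algebraMap, map_pow]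
    rw [heq]
    refine natDegree_sub_lt_of_leadingCoeff_eq (Nat.mul_pos hg (Nat.mul_pos hk hl)) ?_ ?_ ?_
    · rw [Polynomial.natDegree_C_mul (pow_ne_zero _ hb), Polynomial.natDegree_pow, h0]; ring
    · rw [Polynomial.natDegree_C_mul (pow_ne_zero _ ha), Polynomial.natDegree_pow, h1]; ring
    · simp only [Polynomial.leadingCoeff_mul, Polynomial.leadingCoeff_C,
        Polynomial.leadingCoeff_pow]
      exact mul_comm _ _
  obtain ⟨N, c, hc, heqn⟩ := exists_weighted_integral_equation
    (h0 ▸ Nat.mul_pos hg hl : 0 < (w 0).natDegree) (le_refl e.natDegree)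
  set L : MvPolynomial (Fin 2) ℂ :=
    ∑ i ∈ Finset.range N, Polynomial.aeval (X 0 : MvPolynomial (Fin 2) ℂ) (c i) * Q ^ i with hL
  refine ⟨N, Q ^ N + L, ?_, ?_⟩
  · rw [← heqn, map_add, map_pow, hL, map_sum]
    congr 1
    refine Finset.sum_congr rfl fun i _ => ?_
    rw [map_mul, map_pow, ← Polynomial.aeval_algHom_apply, aeval_X, Polynomial.comp_eq_aeval]
  · have hQN : weightHom k l (Q ^ N) = Polynomial.C (Q ^ N) * Polynomial.X ^ (k * l * N) := by
      rw [map_pow, hQhom, mul_pow, ← map_pow, ← pow_mul]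
    have hQNdeg : (weightHom k l (Q ^ N)).degree = (k * l * N : ℕ) := by
      rw [hQN, Polynomial.degree_C_mul_X_pow _ (pow_ne_zero _ hQ0)]
    have hLdeg : (weightHom k l L).degree < (k * l * N : ℕ) := by
      rw [hL, map_sum]
      refine (Polynomial.degree_sum_le _ _).trans_lt ?_
      refine (Finset.sup_lt_iff (WithBot.bot_lt_coe _)).2 fun i hi => ?_
      have hi' := Finset.mem_range.1 hi
      refine Polynomial.degree_le_natDegree.trans_lt (WithBot.coe_lt_coe.2 ?_)
      rw [map_mul, map_pow, hQhom, mul_pow, ← map_pow, ← pow_mul]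
      refine Polynomial.natDegree_mul_le.trans_lt ?_
      have h2 := natDegree_weightHom_aeval_X_le k l (c i)
      have h3 : (Polynomial.C (Q ^ i) * Polynomial.X ^ (k * l * i) :
          Polynomial (MvPolynomial (Fin 2) ℂ)).natDegree ≤ k * l * i :=
        Polynomial.natDegree_C_mul_X_pow_le _ _
      -- The strict drop in the degree of `e` makes every term of `L` have weighted degree below
      -- that of `Q ^ N`.
      have h4 : l * (c i).natDegree < k * l * (N - i) := by
        refine Nat.lt_of_mul_lt_mul_left (a := g) ?_
        calc g * (l * (c i).natDegree) = (w 0).natDegree * (c i).natDegree := by rw [h0, mul_assoc]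
          _ ≤ (N - i) * e.natDegree := hc i hi'
          _ < (N - i) * (g * (k * l)) := Nat.mul_lt_mul_of_pos_left hedeg (Nat.sub_pos_of_lt hi')
          _ = g * (k * l * (N - i)) := by ring
      calc _ < k * l * (N - i) + k * l * i := add_lt_add_of_lt_of_le (h2.trans_lt h4) h3
        _ = k * l * N := by rw [← mul_add, Nat.sub_add_cancel hi'.le]
    rw [← leadingCoeff_weightHom, map_add, Polynomial.leadingCoeff_add_of_degree_lt',
      hQN, Polynomial.leadingCoeff_C_mul_X_pow]
    rwa [hQNdeg]

/-! ### The Nullstellensatz and the leading part of `p` -/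

theorem exists_dvd_pow_of_zeroSet_subset {p H : MvPolynomial (Fin 2) ℂ}
    (h : zeroSet p ⊆ zeroSet H) : ∃ m, p ∣ H ^ m := by
  have hmem : H ∈ (Ideal.span {p}).radical := by
    rw [← vanishingIdeal_zeroLocus_eq_radical (K := ℂ)]
    refine fun z hz => ?_
    have h1 : aeval z p = 0 := hz p (Ideal.mem_span_singleton_self p)
    exact h h1
  obtain ⟨m, hm⟩ := hmem
  exact ⟨m, Ideal.mem_span_singleton.1 hm⟩

/-- The curve `p = 0` is the image of the polynomial map `t ↦ w(t)`. -/
def IsParametrizedBy (p : MvPolynomial (Fin 2) ℂ) (w : Fin 2 → Polynomial ℂ) : Prop :=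
  zeroSet p = Set.range fun t i => (w i).eval t

theorem IsParametrizedBy.exists_dvd_pow {p : MvPolynomial (Fin 2) ℂ} {w : Fin 2 → Polynomial ℂ}
    (hw : IsParametrizedBy p w) {H : MvPolynomial (Fin 2) ℂ} (hH : aeval w H = 0) :
    ∃ m, p ∣ H ^ m := by
  refine exists_dvd_pow_of_zeroSet_subset ?_
  rw [hw]
  rintro _ ⟨t, rfl⟩
  have h1 : (Polynomial.aeval t).comp (aeval w) = aeval (R := ℂ) fun i => (w i).eval t := by
    ext j
    simp
  have h2 := DFunLike.congr_fun h1 H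
  rw [AlgHom.comp_apply, hH, map_zero] at h2
  exact h2.symm

theorem eq_C_mul_pow_of_dvd_pow {p q : MvPolynomial (Fin 2) ℂ} (hq : Irreducible q) {m : ℕ}
    (h : p ∣ q ^ m) : ∃ (c : ℂ) (n : ℕ), c ≠ 0 ∧ p = C c * q ^ n := by
  obtain ⟨n, -, u, hu⟩ :=
    (dvd_prime_pow (UniqueFactorizationMonoid.irreducible_iff_prime.1 hq) m).1 h
  obtain ⟨c, hc, huc⟩ := isUnit_iff_eq_C_of_isReduced.1 (u⁻¹).isUnit
  refine ⟨c, n, hc.ne_zero, ?_⟩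
  rw [← huc, ← hu, mul_comm, mul_assoc, Units.mul_inv, mul_one]

theorem IsParametrizedBy.leadingPart_eq {p : MvPolynomial (Fin 2) ℂ} {w : Fin 2 → Polynomial ℂ}
    (hw : IsParametrizedBy p w) (hp : ∀ c, p ≠ C c) {g k l : ℕ} (hg : 0 < g) (hk : 0 < k)
    (hl : 0 < l) (hkl : k.Coprime l) (h0 : (w 0).natDegree = g * l)
    (h1 : (w 1).natDegree = g * k) :
    ∃ (c : ℂ) (n : ℕ), c ≠ 0 ∧ 1 ≤ n ∧ leadingPart k l p = C c *
      (C ((w 1).leadingCoeff ^ l) * X 0 ^ k - C ((w 0).leadingCoeff ^ k) * X 1 ^ l) ^ n := by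
  obtain ⟨N, H, hH, hHl⟩ := exists_annihilator hg hk hl h0 h1
  obtain ⟨m, r, hr⟩ := hw.exists_dvd_pow hH
  have ha : (w 0).leadingCoeff ≠ 0 := Polynomial.leadingCoeff_ne_zero.2
    (Polynomial.ne_zero_of_natDegree_gt (n := 0) (h0 ▸ Nat.mul_pos hg hl))
  have hb : (w 1).leadingCoeff ≠ 0 := Polynomial.leadingCoeff_ne_zero.2
    (Polynomial.ne_zero_of_natDegree_gt (n := 0) (h1 ▸ Nat.mul_pos hg hk))
  have hdvd : leadingPart k l p ∣
      (C ((w 1).leadingCoeff ^ l) * X 0 ^ k - C ((w 0).leadingCoeff ^ k) * X 1 ^ l) ^ (N * m) := by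
    rw [pow_mul, ← hHl, ← leadingPart_pow, hr, leadingPart_mul]
    exact dvd_mul_right _ _
  obtain ⟨c, n, hc, hcn⟩ := eq_C_mul_pow_of_dvd_pow
    (binomial_irreducible hk hl hkl (pow_ne_zero k ha) (pow_ne_zero l hb)) hdvd
  refine ⟨c, n, hc, Nat.one_le_iff_ne_zero.2 ?_, hcn⟩
  -- Exponent zero would make the leading part constant, so `p` would have weighted degree zero and
  -- be constant.
  rintro rfl
  rw [pow_zero, mul_one] at hcn
  have hhom := leadingPart_isWeightedHomogeneous k l p
  rw [hcn] at hhom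
  have hC : (C c : MvPolynomial (Fin 2) ℂ) ≠ 0 := fun h => hc (C_injective _ _ (h.trans C_0.symm))
  obtain ⟨c', hc'⟩ := eq_C_of_wdegree_eq_zero hk hl
    (hhom.inj_right hC (isWeightedHomogeneous_C (weight k l) c))
  exact hp c' hc'

/-! ### Behaviour under polynomial automorphisms -/

theorem comp_comp_of_leftInverse {σ : Type} {α β : σ → MvPolynomial σ ℂ}
    (h : Function.LeftInverse (polyMap α) (polyMap β)) (p : MvPolynomial σ ℂ) :
    comp (comp p α) β = p := by
  refine MvPolynomial.funext fun z => ?_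
  rw [eval_comp, eval_comp, h z]

theorem IsPrimitive.comp {σ : Type} {α : σ → MvPolynomial σ ℂ} (hα : IsPolyAut α)
    {p : MvPolynomial σ ℂ} (hp : IsPrimitive p) : IsPrimitive (comp p α) := by
  obtain ⟨β, -, hβ⟩ := hα
  have hinv := comp_comp_of_leftInverse hβ p
  refine ⟨fun c hc => hp.1 c ?_, fun f h hf => hp.2 f (PlaneLine.comp h β) ?_⟩
  · rw [← hinv, hc]
    exact bind₁_C_right β c
  · rw [← hinv, hf]
    exact (Polynomial.aeval_algHom_apply (bind₁ β) h f).symm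

/-- The zero set of `p ∘ α` is the preimage of the curve under `α`, so the parametrization is moved
by the inverse `β`. -/
theorem IsParametrizedBy.comp {p : MvPolynomial (Fin 2) ℂ} {w : Fin 2 → Polynomial ℂ}
    (hw : IsParametrizedBy p w) {α β : Fin 2 → MvPolynomial (Fin 2) ℂ}
    (h₁ : Function.LeftInverse (polyMap β) (polyMap α))
    (h₂ : Function.RightInverse (polyMap β) (polyMap α)) :
    IsParametrizedBy (comp p α) fun i => aeval w (β i) := by
  have heval : ∀ (t : ℂ), (fun i => (aeval w (β i)).eval t) =
      polyMap β fun i => (w i).eval t := by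
    intro t
    ext i
    have h : (Polynomial.aeval t).comp (aeval w) = aeval (R := ℂ) fun i => (w i).eval t := by
      ext j
      simp
    exact DFunLike.congr_fun h (β i)
  ext z
  have hz : z ∈ zeroSet (PlaneLine.comp p α) ↔ polyMap α z ∈ zeroSet p := by
    change eval z _ = 0 ↔ eval _ p = 0
    rw [eval_comp]
  rw [hz, hw]
  simp only [heval, Set.mem_range]
  refine exists_congr fun t => ⟨fun h => ?_, fun h => ?_⟩
  · rw [h, h₁]
  · rw [← h, h₂]

/-- The conclusion of the normal form theorem for `p`. -/
def HasNormalForm (p : MvPolynomial (Fin 2) ℂ) : Prop :=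
  ∃ α : Fin 2 → MvPolynomial (Fin 2) ℂ, IsPolyAut α ∧
    ((comp p α).totalDegree = 1 ∨
      ∃ k l n : ℕ, 2 ≤ k ∧ 2 ≤ l ∧ k.Coprime l ∧ 1 ≤ n ∧
        leadingPart k l (comp p α) = (X 0 ^ k + X 1 ^ l) ^ n)

theorem IsPolyAut.comp {σ : Type} {α γ : σ → MvPolynomial σ ℂ} (hα : IsPolyAut α)
    (hγ : IsPolyAut γ) : IsPolyAut fun i => comp (α i) γ := by
  have hmap : ∀ a b : σ → MvPolynomial σ ℂ,
      polyMap (fun i => PlaneLine.comp (a i) b) = polyMap a ∘ polyMap b := by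
    intro a b
    funext z i
    rw [polyMap, eval_comp, Function.comp_apply, polyMap]
  obtain ⟨β, hβ₁, hβ₂⟩ := hα
  obtain ⟨δ, hδ₁, hδ₂⟩ := hγ
  refine ⟨fun i => PlaneLine.comp (δ i) β, ?_, ?_⟩
  · rw [hmap, hmap]; exact hβ₁.comp hδ₁
  · rw [hmap, hmap]; exact hβ₂.comp hδ₂

theorem HasNormalForm.of_comp {p : MvPolynomial (Fin 2) ℂ}
    {α : Fin 2 → MvPolynomial (Fin 2) ℂ} (hα : IsPolyAut α)
    (h : HasNormalForm (comp p α)) : HasNormalForm p := by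
  obtain ⟨γ, hγ, h⟩ := h
  have hcomp : comp (comp p α) γ = comp p (fun i => comp (α i) γ) := bind₁_bind₁ _ _ p
  rw [hcomp] at h
  exact ⟨_, hα.comp hγ, h⟩

/-- The automorphism that adds `c * x_i ^ n` to the coordinate `x_j`. -/
noncomputable def shear (i j : Fin 2) (n : ℕ) (c : ℂ) : Fin 2 → MvPolynomial (Fin 2) ℂ :=
  Function.update X j (X j + C c * X i ^ n)

theorem shear_leftInverse {i j : Fin 2} (hij : i ≠ j) (n : ℕ) (c : ℂ) :
    Function.LeftInverse (polyMap (shear i j n (-c))) (polyMap (shear i j n c)) := by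
  intro z
  ext m
  rcases eq_or_ne m j with rfl | hm
  · simp [polyMap, shear, hij]
  · simp [polyMap, shear, hm]

theorem shear_rightInverse {i j : Fin 2} (hij : i ≠ j) (n : ℕ) (c : ℂ) :
    Function.RightInverse (polyMap (shear i j n (-c))) (polyMap (shear i j n c)) := by
  have := shear_leftInverse hij n (-c)
  rwa [neg_neg] at this

/-! ### The linear case and the rescaling of the leading part -/

theorem totalDegree_C_mul_X_sub_C {σ : Type} {c : ℂ} (hc : c ≠ 0) (i : σ) (a : ℂ) :
    (C c * (X i - C a) : MvPolynomial σ ℂ).totalDegree = 1 := by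
  classical
  refine le_antisymm ?_ ?_
  · refine (totalDegree_mul _ _).trans ?_
    rw [totalDegree_C, zero_add]
    refine (totalDegree_sub _ _).trans ?_
    rw [totalDegree_C, totalDegree_X, max_eq_left zero_le_one]
  · have h : coeff (Finsupp.single i 1) (C c * (X i - C a) : MvPolynomial σ ℂ) ≠ 0 := by
      rw [coeff_C_mul, coeff_sub, coeff_X, if_pos rfl, coeff_C, if_neg, sub_zero, mul_one]
      · exact hc
      · exact (Finsupp.single_ne_zero.2 one_ne_zero).symm
    simpa using le_totalDegree (mem_support_iff.2 h)

theorem irreducible_X_sub_C {σ : Type} (i : σ) (a : ℂ) :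
    Irreducible (X i - C a : MvPolynomial σ ℂ) := by
  classical
  refine irreducible_of_totalDegree_eq_one ?_ fun c hc => ?_
  · simpa using totalDegree_C_mul_X_sub_C one_ne_zero i a
  · refine IsUnit.mk0 c fun h0 => ?_
    have := hc (Finsupp.single i 1)
    rw [coeff_sub, coeff_X, if_pos rfl, coeff_C,
      if_neg (Finsupp.single_ne_zero.2 one_ne_zero).symm, sub_zero,
      h0, zero_dvd_iff] at this
    exact one_ne_zero this

theorem IsParametrizedBy.totalDegree_eq_one {p : MvPolynomial (Fin 2) ℂ}
    {w : Fin 2 → Polynomial ℂ} (hw : IsParametrizedBy p w) (hp : IsPrimitive p) {i : Fin 2}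
    (hi : (w i).natDegree = 0) : p.totalDegree = 1 := by
  obtain ⟨a, ha⟩ := Polynomial.natDegree_eq_zero.1 hi
  obtain ⟨m, hm⟩ := hw.exists_dvd_pow (H := X i - C a) (by
    rw [map_sub, aeval_X, ← ha]
    exact sub_eq_zero.2 (aeval_C _ _).symm)
  obtain ⟨c, n, hc, hcn⟩ := eq_C_mul_pow_of_dvd_pow (irreducible_X_sub_C i a) hm
  -- Here `p` is `c t ^ n` evaluated at `X i - C a`, so primitivity gives `n ≤ 1`.
  have hn := hp.2 (Polynomial.C c * Polynomial.X ^ n) (X i - C a) (by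
    rw [map_mul, map_pow, Polynomial.aeval_X, Polynomial.aeval_C, hcn]
    rfl)
  rw [Polynomial.natDegree_C_mul_X_pow _ _ hc] at hn
  interval_cases n
  · exact absurd (by rw [hcn, pow_zero, mul_one]) (hp.1 c)
  · rw [hcn, pow_one, totalDegree_C_mul_X_sub_C hc]

/-- A diagonal substitution commutes with the grading: it acts on the coefficients in `z`,
injectively, and so preserves which one is leading. -/
theorem leadingPart_comp_diagonal (k l : ℕ) (p : MvPolynomial (Fin 2) ℂ) {s : Fin 2 → ℂ}
    (hs : ∀ i, s i ≠ 0) :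
    leadingPart k l (comp p fun i => C (s i) * X i) =
      comp (leadingPart k l p) fun i => C (s i) * X i := by
  have hinj : Function.Injective (bind₁ fun i => (C (s i) * X i : MvPolynomial (Fin 2) ℂ)) := by
    refine Function.LeftInverse.injective (g := bind₁ fun i => C (s i)⁻¹ * X i)
      (comp_comp_of_leftInverse fun z => ?_)
    ext i
    simp [polyMap, hs i]
  have hmap : ∀ q : MvPolynomial (Fin 2) ℂ,
      weightHom k l (bind₁ (fun i => C (s i) * X i) q) =
        Polynomial.map (bind₁ fun i => (C (s i) * X i : MvPolynomial (Fin 2) ℂ)).toRingHom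
          (weightHom k l q) := by
    intro q
    induction q using MvPolynomial.induction_on with
    | C a => rw [bind₁_C_right, weightHom_C, Polynomial.map_C]; simp
    | add p q hp hq => rw [map_add, map_add, map_add, Polynomial.map_add, hp, hq]
    | mul_X p i hp =>
      rw [map_mul, map_mul, map_mul, Polynomial.map_mul, hp, bind₁_X_right, map_mul, weightHom_X,
        weightHom_C]
      simp [mul_assoc]
  rw [← leadingCoeff_weightHom, ← leadingCoeff_weightHom, comp, hmap]
  exact Polynomial.leadingCoeff_map_of_injective hinj _

theorem isPolyAut_diagonal {σ : Type} {s : σ → ℂ} (hs : ∀ i, s i ≠ 0) :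
    IsPolyAut fun i => (C (s i) * X i : MvPolynomial σ ℂ) := by
  refine ⟨fun i => C (s i)⁻¹ * X i, fun z => ?_, fun z => ?_⟩ <;>
  · ext i
    simp [polyMap, hs i]

theorem hasNormalForm_of_leadingPart {p : MvPolynomial (Fin 2) ℂ} {k l n : ℕ} (hk : 2 ≤ k)
    (hl : 2 ≤ l) (hkl : k.Coprime l) (hn : 1 ≤ n) {a b c : ℂ} (ha : a ≠ 0) (hb : b ≠ 0)
    (hc : c ≠ 0) (h : leadingPart k l p = C c * (C b * X 0 ^ k - C a * X 1 ^ l) ^ n) :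
    HasNormalForm p := by
  -- The outer constant is moved inside the `n`-th power; `s` and `t` then make the two coefficients
  -- of the binomial equal to 1.
  obtain ⟨c₀, rfl⟩ := IsAlgClosed.exists_pow_nat_eq c hn
  have hc₀ : c₀ ≠ 0 := by
    rintro rfl
    exact hc (zero_pow (Nat.one_le_iff_ne_zero.1 hn))
  obtain ⟨s, hs⟩ := IsAlgClosed.exists_pow_nat_eq (c₀ * b)⁻¹ (show 0 < k by omega)
  obtain ⟨t, ht⟩ := IsAlgClosed.exists_pow_nat_eq (-(c₀ * a)⁻¹) (show 0 < l by omega)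
  have hs0 : s ≠ 0 := by
    rintro rfl
    rw [zero_pow (by omega)] at hs
    exact inv_ne_zero (mul_ne_zero hc₀ hb) hs.symm
  have ht0 : t ≠ 0 := by
    rintro rfl
    rw [zero_pow (by omega)] at ht
    exact neg_ne_zero.2 (inv_ne_zero (mul_ne_zero hc₀ ha)) ht.symm
  have hne : ∀ i, (![s, t] : Fin 2 → ℂ) i ≠ 0 := by
    intro i
    fin_cases i
    · exact hs0
    · exact ht0
  refine ⟨_, isPolyAut_diagonal hne, Or.inr ⟨k, l, n, hk, hl, hkl, hn, ?_⟩⟩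
  rw [leadingPart_comp_diagonal k l p hne, h, comp]
  have h₁ : c₀ * b * s ^ k = 1 := by rw [hs, mul_inv_cancel₀ (mul_ne_zero hc₀ hb)]
  have h₂ : c₀ * a * t ^ l = -1 := by rw [ht, mul_neg, mul_inv_cancel₀ (mul_ne_zero hc₀ ha)]
  rw [C_pow, ← mul_pow, map_pow]
  congr 1
  simp only [map_mul, map_sub, map_pow, bind₁_X_right, bind₁_C_right]
  change C c₀ * (C b * (C s * X 0) ^ k - C a * (C t * X 1) ^ l) = _
  have h₁' := congrArg (C (σ := Fin 2)) h₁
  have h₂' := congrArg (C (σ := Fin 2)) h₂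
  simp only [C_mul, C_pow, C_neg, C_1] at h₁' h₂'
  linear_combination (X 0 ^ k) * h₁' - (X 1 ^ l) * h₂'

/-! ### Descent on the degrees of the parametrization -/

theorem natDegree_shear_lt {w : Fin 2 → Polynomial ℂ} {i j : Fin 2} (hij : i ≠ j) {n : ℕ}
    (hj : 0 < (w j).natDegree) (hn : (w j).natDegree = n * (w i).natDegree) :
    ∃ c : ℂ, (aeval w (shear i j n (-c) j)).natDegree < (w j).natDegree ∧
      aeval w (shear i j n (-c) i) = w i := by
  have hi : (w i).leadingCoeff ≠ 0 := by
    refine Polynomial.leadingCoeff_ne_zero.2 fun h => ?_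
    rw [hn, h, Polynomial.natDegree_zero, mul_zero] at hj
    exact hj.false
  have hc : (w j).leadingCoeff / (w i).leadingCoeff ^ n ≠ 0 :=
    div_ne_zero (Polynomial.leadingCoeff_ne_zero.2 (Polynomial.ne_zero_of_natDegree_gt hj))
      (pow_ne_zero _ hi)
  refine ⟨(w j).leadingCoeff / (w i).leadingCoeff ^ n, ?_, ?_⟩
  · have h : aeval w (shear i j n (-((w j).leadingCoeff / (w i).leadingCoeff ^ n)) j) =
        w j - Polynomial.C ((w j).leadingCoeff / (w i).leadingCoeff ^ n) * w i ^ n := by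
      rw [shear, Function.update_self, C_neg, neg_mul, ← sub_eq_add_neg, map_sub, map_mul, map_pow,
        aeval_X, aeval_X, aeval_C]
      rfl
    rw [h]
    refine natDegree_sub_lt_of_leadingCoeff_eq hj rfl ?_ ?_
    · rw [Polynomial.natDegree_C_mul hc, Polynomial.natDegree_pow, hn]
    · rw [Polynomial.leadingCoeff_mul, Polynomial.leadingCoeff_C, Polynomial.leadingCoeff_pow,
        div_mul_cancel₀ _ (pow_ne_zero _ hi)]
  · rw [shear, Function.update_of_ne hij, aeval_X]

theorem IsParametrizedBy.hasNormalForm {p : MvPolynomial (Fin 2) ℂ} {w : Fin 2 → Polynomial ℂ}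
    (hw : IsParametrizedBy p w) (hp : IsPrimitive p) : HasNormalForm p := by
  induction hd : (w 0).natDegree + (w 1).natDegree using Nat.strong_induction_on
    generalizing p w with
  | _ d ih =>
  subst hd
  have hlin : ∀ i, (w i).natDegree = 0 → HasNormalForm p := fun i hi =>
    ⟨X, ⟨X, fun z => funext fun i => by simp [polyMap], fun z => funext fun i => by simp [polyMap]⟩,
      Or.inl (by rw [PlaneLine.comp, bind₁_X_left]; exact hw.totalDegree_eq_one hp hi)⟩
  rcases Nat.eq_zero_or_pos (w 0).natDegree with h0 | h0
  · exact hlin 0 h0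
  rcases Nat.eq_zero_or_pos (w 1).natDegree with h1 | h1
  · exact hlin 1 h1
  have hstep : ∀ (i j : Fin 2) (n : ℕ), i ≠ j → 0 < (w j).natDegree →
      (w j).natDegree = n * (w i).natDegree → HasNormalForm p := by
    intro i j n hij hj hn
    obtain ⟨c, hcj, hci⟩ := natDegree_shear_lt hij hj hn
    have hα : IsPolyAut (shear i j n c) :=
      ⟨_, shear_leftInverse hij n c, shear_rightInverse hij n c⟩
    -- Composing `p` with the shear by `c` moves the curve by the shear by `-c`, which lowers the
    -- degree of `w j` and fixes `w i`.
    refine HasNormalForm.of_comp hα (ih _ ?_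
      (hw.comp (shear_leftInverse hij n c) (shear_rightInverse hij n c)) (hp.comp hα) rfl)
    fin_cases i <;> fin_cases j
    · exact absurd rfl hij
    · exact add_lt_add_of_le_of_lt (congrArg Polynomial.natDegree hci).le hcj
    · exact add_lt_add_of_lt_of_le hcj (congrArg Polynomial.natDegree hci).le
    · exact absurd rfl hij
  -- The reduced degree ratio is `l : k`; a value of 1 means divisibility, hence a shear.
  obtain ⟨g, l, k, hg, hkl, hl, hk⟩ := Nat.exists_coprime' (Nat.gcd_pos_of_pos_left
    (w 1).natDegree h0)
  have hlpos : 0 < l := Nat.pos_of_mul_pos_right (hl ▸ h0)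
  have hkpos : 0 < k := Nat.pos_of_mul_pos_right (hk ▸ h1)
  rcases eq_or_ne l 1 with rfl | hl1
  · exact hstep 0 1 k (by decide) h1 (by rw [hk, hl, one_mul])
  rcases eq_or_ne k 1 with rfl | hk1
  · exact hstep 1 0 l (by decide) h0 (by rw [hk, hl, one_mul])
  obtain ⟨c, n, hc, hn, hcn⟩ := hw.leadingPart_eq hp.1 hg hkpos hlpos hkl.symm
    (hl.trans (mul_comm _ _)) (hk.trans (mul_comm _ _))
  refine hasNormalForm_of_leadingPart (by omega) (by omega) hkl.symm hn (pow_ne_zero _ ?_)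
    (pow_ne_zero _ ?_) hc hcn
  · exact Polynomial.leadingCoeff_ne_zero.2 (Polynomial.ne_zero_of_natDegree_gt h0)
  · exact Polynomial.leadingCoeff_ne_zero.2 (Polynomial.ne_zero_of_natDegree_gt h1)

/-! ### From an isomorphism with the line to a parametrization -/

theorem exists_isParametrizedBy {p : MvPolynomial (Fin 2) ℂ}
    (h : AlgIsomorphic (zeroSet p) (Set.univ : Set (Fin 1 → ℂ))) :
    ∃ w, IsParametrizedBy p w := by
  obtain ⟨F, G, -, hG, hFG, -⟩ := h
  refine ⟨fun i => aeval (fun _ => Polynomial.X) (G i), ?_⟩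
  have heval : ∀ t : ℂ, (fun i => (aeval (fun _ => Polynomial.X) (G i)).eval t) =
      polyMap G fun _ => t := by
    intro t
    ext i
    have h : (Polynomial.aeval t).comp (aeval fun _ : Fin 1 => Polynomial.X) =
        aeval (R := ℂ) fun _ => t := by
      ext j
      simp
    exact DFunLike.congr_fun h (G i)
  ext z
  simp only [heval, Set.mem_range]
  refine ⟨fun hz => ⟨polyMap F z 0, ?_⟩, ?_⟩
  · rw [← hFG hz]
    congr 1
    ext i
    rw [Subsingleton.elim i 0, hFG hz]
  · rintro ⟨t, rfl⟩
    exact hG (Set.mem_univ _)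

end PlaneLine

theorem lemma1p1 (p : MvPolynomial (Fin 2) ℂ) (hp : PlaneLine.IsPrimitive p)
    (hline : PlaneLine.AlgIsomorphic (PlaneLine.zeroSet p) (Set.univ : Set (Fin 1 → ℂ))) :
    ∃ α : Fin 2 → MvPolynomial (Fin 2) ℂ, PlaneLine.IsPolyAut α ∧
      ((PlaneLine.comp p α).totalDegree = 1 ∨
        ∃ k l n : ℕ, 2 ≤ k ∧ 2 ≤ l ∧ k.Coprime l ∧ 1 ≤ n ∧
          PlaneLine.leadingPart k l (PlaneLine.comp p α) =
            (MvPolynomial.X 0 ^ k + MvPolynomial.X 1 ^ l) ^ n) := by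
  obtain ⟨w, hw⟩ := PlaneLine.exists_isParametrizedBy hline
  exact hw.hasNormalForm hp
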